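/- Let $n\in\mathbb N$, $A_1,A_2\in\mathbb R^{n\times n}$, $e_1,e_2,c\in\mathbb R^n$ and $f\in\mathbb R$. Consider the differential inclusion $\dot x(t)\in G(x(t))$ with $$ G(x)=\begin{cases}\{A_1x+e_1\}&\text{if } c^Tx+f<0,\\ \operatorname{conv}\{A_1x+e_1,\,A_2x+e_2\}&\text{if } c^Tx+f=0,\\ \{A_2x+e_2\}&\text{if } c^Tx+f>0.\end{cases} $$ A Filippov solution for the initial state $\xi\in\mathbb R^n$ is a function $x:\mathbb R\to\mathbb R^n$, absolutely continuous on every compact interval, with $x(0)=\xi$ and $\dot x(t)\in G(x(t))$ for almost all $t\in\mathbb R$. Right-uniqueness of Filippov solutions holds at $\xi$ if for any two Filippov solutions $x,x'$ for the initial state $\xi$ there is $\epsilon>0$ such that $x(t)=x'(t)$ for all $t\in[0,\epsilon)$. For vectors $u,v$ write $u\succ v$ if $u-v$ is nonzero and its first nonzero entry is positive. Suppose that there is a $3\times3$ lower triangular matrix $M$ with positive diagonal entries such that $$ \begin{bmatrix}c^T\\ c^TA_1\\ c^TA_1^2\end{bmatrix}=M\begin{bmatrix}c^T\\ c^TA_2\\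 c^TA_2^2\end{bmatrix},\qquad \begin{bmatrix}f\\ c^Te_1\\ c^TA_1e_1\end{bmatrix}\succ M\begin{bmatrix}f\\ c^Te_2\\ c^TA_2e_2\end{bmatrix}. $$ Then right-uniqueness of Filippov solutions holds at every $\xi\in\mathbb R^n\setminus\Omega$, where $\Omega$ is the set of all $\xi\in\mathbb R^n$ such that $$ \begin{bmatrix}c^T\\ c^TA_j\\ c^TA_j^2\end{bmatrix}\xi+\begin{bmatrix}f\\ c^Te_j\\ c^TA_je_j\end{bmatrix}=0\quad\text{and}\quad(-1)^k\bigl(c^TA_k^2\xi+c^TA_ke_k\bigr)<0 $$ for some $k,j\in\{1,2\}$ with $k\neq j$. -/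

import Mathlib

open Matrix MeasureTheory

/-- The data of a bimodal piecewise affine system on `ℝⁿ`: mode 1 is `A₁ x + e₁`
(active where `cᵀ x + f < 0`), mode 2 is `A₂ x + e₂` (active where `cᵀ x + f > 0`). -/
structure BimodalSystem (n : ℕ) where
  A₁ : Matrix (Fin n) (Fin n) ℝ
  A₂ : Matrix (Fin n) (Fin n) ℝ
  e₁ : Fin n → ℝ
  e₂ : Fin n → ℝ
  c : Fin n → ℝ
  f : ℝ

/-- The `3 × n` matrix with rows `cᵀ`, `cᵀ A`, `cᵀ A²`. -/
def obsMatrix {n : ℕ} (c : Fin n → ℝ) (A : Matrix (Fin n) (Fin n) ℝ) :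
    Matrix (Fin 3) (Fin n) ℝ :=
  Matrix.of ![c, c ᵥ* A, c ᵥ* (A ^ 2)]

/-- The affine vector `(f, cᵀ e, cᵀ A e)`. -/
def affineVec {n : ℕ} (c : Fin n → ℝ) (f : ℝ) (A : Matrix (Fin n) (Fin n) ℝ)
    (e : Fin n → ℝ) : Fin 3 → ℝ :=
  ![f, c ⬝ᵥ e, c ⬝ᵥ (A *ᵥ e)]

/-- `v ≻ 0`: the vector `v` is nonzero and its first nonzero entry is positive. -/
def LexPos {m : ℕ} (v : Fin m → ℝ) : Prop :=
  ∃ i, 0 < v i ∧ ∀ j, j < i → v j = 0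

/-- The lexicographic inequality `u ≻ v`, that is `u - v ≻ 0`. -/
def LexGT {m : ℕ} (u v : Fin m → ℝ) : Prop :=
  LexPos (u - v)

namespace BimodalSystem

variable {n : ℕ}

/-- The set-valued right-hand side `G` of the convexified differential inclusion. -/
noncomputable def G (S : BimodalSystem n) (x : Fin n → ℝ) : Set (Fin n → ℝ) :=
  if S.c ⬝ᵥ x + S.f < 0 then {S.A₁ *ᵥ x + S.e₁}
  else if S.c ⬝ᵥ x + S.f = 0 then
    convexHull ℝ {S.A₁ *ᵥ x + S.e₁, S.A₂ *ᵥ x + S.e₂}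
  else {S.A₂ *ᵥ x + S.e₂}

/-- `x : ℝ → ℝⁿ` is a Filippov solution for the initial state `ξ`: it is absolutely continuous
(on every compact interval), `x 0 = ξ`, and `x' t ∈ G (x t)` for almost all `t ∈ ℝ`.
All norms on `ℝⁿ` being equivalent, the choice of norm is immaterial here. -/
structure IsFilippovSolution (S : BimodalSystem n) (ξ : Fin n → ℝ) (x : ℝ → Fin n → ℝ) :
    Prop where
  absCont : ∀ a b : ℝ, AbsolutelyContinuousOnInterval x a b
  init : x 0 = ξ
  incl : ∀ᵐ t : ℝ, ∃ v ∈ S.G (x t), HasDerivAt x v t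

/-- The function `x` is right-unique among the Filippov solutions for the initial state `ξ`. -/
def IsRightUnique (S : BimodalSystem n) (ξ : Fin n → ℝ) (x : ℝ → Fin n → ℝ) : Prop :=
  ∀ x' : ℝ → Fin n → ℝ, S.IsFilippovSolution ξ x' →
    ∃ ε : ℝ, 0 < ε ∧ ∀ t ∈ Set.Ico 0 ε, x t = x' t

/-- Right-uniqueness of Filippov solutions holds at the state `ξ`: every Filippov solution for
the initial state `ξ` is right-unique. -/
def RightUniqueAt (S : BimodalSystem n) (ξ : Fin n → ℝ) : Prop :=
  ∀ x : ℝ → Fin n → ℝ, S.IsFilippovSolution ξ x → S.IsRightUnique ξ x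

/-- The exceptional set: all `ξ` such that, for some `j ≠ k` in `{1, 2}`,
`col(cᵀ, cᵀ A_j, cᵀ A_j²) ξ + (f, cᵀ e_j, cᵀ A_j e_j) = 0` and
`(-1)^k (cᵀ A_k² ξ + cᵀ A_k e_k) < 0`. -/
def exceptionalSet (S : BimodalSystem n) : Set (Fin n → ℝ) :=
  {ξ | (obsMatrix S.c S.A₁ *ᵥ ξ + affineVec S.c S.f S.A₁ S.e₁ = 0 ∧
          (-1 : ℝ) ^ 2 * (S.c ⬝ᵥ ((S.A₂ ^ 2) *ᵥ ξ) + S.c ⬝ᵥ (S.A₂ *ᵥ S.e₂)) < 0) ∨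
       (obsMatrix S.c S.A₂ *ᵥ ξ + affineVec S.c S.f S.A₂ S.e₂ = 0 ∧
          (-1 : ℝ) ^ 1 * (S.c ⬝ᵥ ((S.A₁ ^ 2) *ᵥ ξ) + S.c ⬝ᵥ (S.A₁ *ᵥ S.e₁)) < 0)}

end BimodalSystem

/-! Put `y = cᵀx + f`, and write `F₁`, `F₂` for the two affine fields. Off the surface `y = 0` a
solution follows a single mode for a short time and Grönwall applies. On the surface, the matrix
identity ties the output derivatives of mode 1 to those of mode 2 through `M`, up to a constant gap
`d` that is lexicographically positive; `y = 0` at some point forces `d 0 = 0`.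

If `d 1 > 0`, then either both `cᵀF₁` and `cᵀF₂` have the same strict sign and every solution
crosses, or `cᵀF₁ > cᵀF₂`. In the latter case the switching is monotone in `y`, which yields a
one-sided estimate and hence uniqueness (`eventuallyEq_of_jump_pos`).

If `d 1 = 0 < d 2`, the first derivatives share their sign. When both vanish, the second derivatives
`cᵀA₁F₁` and `cᵀA₂F₂` decide. Equal strict signs give a second-order crossing. If mode 2 pulls down
and mode 1 pushes up, an energy argument (`eq_zero_of_second_order_attraction`) keeps solutions on
`y = cᵀF₂ = 0`, where the convex multiplier is determined by the state in a Lipschitz way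
(`eventuallyEq_of_second_order_sliding`). The remaining sign patterns are ruled out by `d 2 > 0` or
put `ξ` in the exceptional set. -/

section

open Filter Set Topology

variable {E : Type*} [NormedAddCommGroup E] [NormedSpace ℝ E]

/-! ### Comparison and Grönwall arguments with almost-everywhere derivatives -/

namespace AbsolutelyContinuousOnInterval

variable {X Y : Type*} [PseudoMetricSpace X] [PseudoMetricSpace Y]

theorem lipschitz_comp {x : ℝ → X} {a b : ℝ} {K : NNReal} {Φ : X → Y}
    (hΦ : LipschitzWith K Φ) (hx : AbsolutelyContinuousOnInterval x a b) :
    AbsolutelyContinuousOnInterval (fun t => Φ (x t)) a b := by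
  unfold AbsolutelyContinuousOnInterval at hx ⊢
  have h := hx.const_mul (K : ℝ)
  rw [mul_zero] at h
  refine squeeze_zero (fun _ => Finset.sum_nonneg fun _ _ => dist_nonneg) (fun _ => ?_) h
  rw [Finset.mul_sum]
  exact Finset.sum_le_sum fun _ _ => hΦ.dist_le_mul _ _

theorem max_zero {y : ℝ → ℝ} {a b : ℝ} (hy : AbsolutelyContinuousOnInterval y a b) :
    AbsolutelyContinuousOnInterval (fun t => max (y t) 0) a b :=
  lipschitz_comp (x := y) (Φ := fun s => max s 0) (LipschitzWith.id.max_const 0) hy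

theorem clm_comp_add_const {F G : Type*} [NormedAddCommGroup F] [NormedSpace ℝ F]
    [NormedAddCommGroup G] [NormedSpace ℝ G] {x : ℝ → F} {a b : ℝ}
    (hx : AbsolutelyContinuousOnInterval x a b) (ψ : F →L[ℝ] G) (c : G) :
    AbsolutelyContinuousOnInterval (fun t => ψ (x t) + c) a b := by
  refine hx.lipschitz_comp (K := ‖ψ‖₊) (Φ := fun p => ψ p + c)
    (LipschitzWith.of_dist_le_mul fun p q => ?_)
  rw [dist_add_right]
  exact ψ.lipschitz.dist_le_mul p q

theorem le_of_ae_hasDerivAt_nonneg {φ : ℝ → ℝ} {a b : ℝ} (hab : a ≤ b)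
    (hφ : AbsolutelyContinuousOnInterval φ a b)
    (h : ∀ᵐ t : ℝ, t ∈ Ioo a b → ∃ v, 0 ≤ v ∧ HasDerivAt φ v t) : φ a ≤ φ b := by
  rw [← sub_nonneg, ← hφ.integral_deriv_eq_sub, intervalIntegral.integral_of_le hab,
    integral_Ioc_eq_integral_Ioo]
  refine integral_nonneg_of_ae ?_
  refine (ae_restrict_iff' measurableSet_Ioo).2 ?_
  filter_upwards [h] with t ht hI
  obtain ⟨v, hv, hd⟩ := ht hI
  simpa [hd.deriv] using hv

/-- Equal end values would make the monotone function `φ` constant, contradicting a positive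
derivative at even one interior point. -/
theorem lt_of_ae_hasDerivAt_pos {φ : ℝ → ℝ} {a b : ℝ} (hab : a < b)
    (hφ : AbsolutelyContinuousOnInterval φ a b)
    (h : ∀ᵐ t : ℝ, t ∈ Ioo a b → ∃ v, 0 < v ∧ HasDerivAt φ v t) : φ a < φ b := by
  have mono : ∀ s t, a ≤ s → s ≤ t → t ≤ b → φ s ≤ φ t := by
    intro s t has hst htb
    refine (hφ.mono ?_).le_of_ae_hasDerivAt_nonneg hst ?_
    · rw [uIcc_of_le hst, uIcc_of_le hab.le]; exact Icc_subset_Icc has htb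
    · filter_upwards [h] with r hr hI
      obtain ⟨v, hv, hd⟩ := hr ⟨by linarith [hI.1], by linarith [hI.2]⟩
      exact ⟨v, hv.le, hd⟩
  refine lt_of_le_of_ne (mono a b le_rfl hab.le le_rfl) fun heq => ?_
  have hne : volume (Ioo a b) ≠ 0 := by simp [hab]
  obtain ⟨t, htI, ht⟩ : ∃ t ∈ Ioo a b, t ∈ Ioo a b → ∃ v, 0 < v ∧ HasDerivAt φ v t := by
    by_contra! hcon
    refine hne (measure_mono_null ?_ h)
    intro t htI hgood
    obtain ⟨v, hv, hd⟩ := hgood htI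
    exact (hcon t htI).2 v hv hd
  obtain ⟨v, hv, hd⟩ := ht htI
  have hconst : φ =ᶠ[𝓝 t] fun _ => φ a := by
    filter_upwards [Ioo_mem_nhds htI.1 htI.2] with s hs
    exact le_antisymm (heq ▸ mono s b hs.1.le hs.2.le le_rfl) (mono a s le_rfl hs.1.le hs.2.le)
  have := hd.unique ((hasDerivAt_const t (φ a)).congr_of_eventuallyEq hconst)
  exact hv.ne' this

/-- Grönwall's inequality for absolutely continuous functions. -/
theorem nonpos_of_ae_hasDerivAt_le_mul {φ : ℝ → ℝ} {T C : ℝ} (hT : 0 ≤ T)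
    (hφ : AbsolutelyContinuousOnInterval φ 0 T) (h0 : φ 0 ≤ 0)
    (h : ∀ᵐ t : ℝ, t ∈ Ioo 0 T → ∃ v, v ≤ C * φ t ∧ HasDerivAt φ v t) : φ T ≤ 0 := by
  -- The integrating factor carries a minus sign so that the nondecreasing version of the comparison
  -- lemma applies.
  have hexp : AbsolutelyContinuousOnInterval (fun t : ℝ => -Real.exp (-C * t)) 0 T := by
    refine ContDiffOn.absolutelyContinuousOnInterval (ContDiff.contDiffOn ?_)
    fun_prop
  have key := (hexp.fun_mul hφ).le_of_ae_hasDerivAt_nonneg hT ?_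
  · simp only [mul_zero, Real.exp_zero] at key
    have := Real.exp_pos (-C * T)
    nlinarith
  · filter_upwards [h] with t ht hI
    obtain ⟨v, hv, hd⟩ := ht hI
    have he : HasDerivAt (fun t : ℝ => -Real.exp (-C * t)) (-(Real.exp (-C * t) * (-C))) t := by
      simpa using (((hasDerivAt_id t).const_mul (-C)).exp).fun_neg
    refine ⟨_, ?_, he.mul hd⟩
    have := Real.exp_pos (-C * t)
    nlinarith

end AbsolutelyContinuousOnInterval

theorem HasDerivAt.le_norm_of_hasDerivAt_norm {z : ℝ → E} {z' : E} {d t : ℝ}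
    (hz : HasDerivAt z z' t) (hd : HasDerivAt (fun s => ‖z s‖) d t) : d ≤ ‖z'‖ := by
  refine (le_abs_self d).trans ?_
  rw [← Real.norm_eq_abs]
  refine le_of_tendsto_of_tendsto hd.tendsto_slope.norm hz.tendsto_slope.norm
    (Eventually.of_forall fun s => ?_)
  simp only [slope, vsub_eq_sub, norm_smul, Real.norm_eq_abs]
  gcongr
  exact abs_norm_sub_norm_le _ _

/-- The positive part is itself absolutely continuous, so it is differentiable almost everywhere;
where `y ≤ 0` it attains its minimum, so its derivative there is zero. -/
theorem ae_hasDerivAt_max_zero {y : ℝ → ℝ} {T : ℝ} (hT : 0 ≤ T)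
    (hy : AbsolutelyContinuousOnInterval y 0 T) :
    ∀ᵐ t : ℝ, t ∈ Ioo 0 T → ∀ y', HasDerivAt y y' t →
      ∃ d, HasDerivAt (fun s => max (y s) 0) d t ∧
        (0 < y t → d = y') ∧ (y t ≤ 0 → d = 0) := by
  have hm : AbsolutelyContinuousOnInterval (fun s => max (y s) 0) 0 T := hy.max_zero
  filter_upwards [hm.ae_differentiableAt] with t ht hI y' hd
  have hdm := (ht (by rw [uIcc_of_le hT]; exact ⟨hI.1.le, hI.2.le⟩)).hasDerivAt
  refine ⟨_, hdm, fun hpos => ?_, fun hle => ?_⟩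
  · refine hdm.unique (hd.congr_of_eventuallyEq ?_)
    filter_upwards [hd.continuousAt.eventually (lt_mem_nhds hpos)] with s hs
    exact max_eq_left (le_of_lt hs)
  · refine IsLocalMin.hasDerivAt_eq_zero (Eventually.of_forall fun s => ?_) hdm
    simp [max_eq_right hle]

/-- A Grönwall uniqueness principle: a one-sided bound suffices for the real component. -/
theorem eq_zero_of_ae_hasDerivAt_bound {z : ℝ → E} {δ : ℝ → ℝ} {T K : ℝ} (hT : 0 ≤ T)
    (hz : AbsolutelyContinuousOnInterval z 0 T) (hδ : AbsolutelyContinuousOnInterval δ 0 T)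
    (hz0 : z 0 = 0) (hδ0 : δ 0 = 0)
    (h : ∀ᵐ t : ℝ, t ∈ Ioo 0 T → ∃ z' d, HasDerivAt z z' t ∧ HasDerivAt δ d t ∧
      ‖z'‖ ≤ K * (‖z t‖ + |δ t|) ∧ δ t * d ≤ K * |δ t| * (‖z t‖ + |δ t|)) :
    z T = 0 ∧ δ T = 0 := by
  have hnz : AbsolutelyContinuousOnInterval (fun t => ‖z t‖) 0 T :=
    hz.lipschitz_comp lipschitzWith_one_norm
  have hnδ : AbsolutelyContinuousOnInterval (fun t => |δ t|) 0 T :=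
    hδ.lipschitz_comp lipschitzWith_one_norm
  -- Each of `‖z‖` and `|δ|` grows at rate at most `|K| (‖z‖ + |δ|)`. For `|δ|` only the
  -- sign-weighted bound on `δ * d` is needed, since at zeros of `δ` the function `|δ|` is minimal.
  have key := (hnz.fun_add hnδ).nonpos_of_ae_hasDerivAt_le_mul (C := 2 * |K|) hT
    (by simp [hz0, hδ0]) ?_
  · have h1 := norm_nonneg (z T)
    have h2 := abs_nonneg (δ T)
    exact ⟨norm_eq_zero.1 (by linarith), abs_eq_zero.1 (by linarith)⟩
  · filter_upwards [h, hnz.ae_differentiableAt, hnδ.ae_differentiableAt] with t ht h1 h2 hI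
    have hI' : t ∈ uIcc 0 T := by rw [uIcc_of_le hT]; exact ⟨hI.1.le, hI.2.le⟩
    obtain ⟨z', d, hz', hd, hb, hb'⟩ := ht hI
    have k1 := (h1 hI').hasDerivAt
    have k2 := (h2 hI').hasDerivAt
    refine ⟨_, ?_, k1.add k2⟩
    have hV : 0 ≤ ‖z t‖ + |δ t| := by positivity
    have b1 := (hz'.le_norm_of_hasDerivAt_norm k1).trans hb
    have hK := mul_le_mul_of_nonneg_right (le_abs_self K) hV
    have b2 : deriv (fun t => |δ t|) t ≤ |K| * (‖z t‖ + |δ t|) := by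
      rcases lt_trichotomy (δ t) 0 with hneg | hzero | hpos
      · have e : deriv (fun t => |δ t|) t = -d := by
          refine k2.unique (hd.neg.congr_of_eventuallyEq ?_)
          filter_upwards [hd.continuousAt.eventually (gt_mem_nhds hneg)] with s hs
          exact abs_of_neg hs
        rw [e]
        rw [abs_of_neg hneg] at hb' hK ⊢
        have : -d ≤ K * (‖z t‖ + -δ t) := by
          have : 0 < -δ t := by linarith
          refine le_of_mul_le_mul_left ?_ this
          linarith
        linarith
      · have e : deriv (fun t => |δ t|) t = 0 := by
          refine IsLocalMin.hasDerivAt_eq_zero (Eventually.of_forall fun s => ?_) k2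
          simp [hzero]
        rw [e]; positivity
      · have e : deriv (fun t => |δ t|) t = d := by
          refine k2.unique (hd.congr_of_eventuallyEq ?_)
          filter_upwards [hd.continuousAt.eventually (lt_mem_nhds hpos)] with s hs
          exact abs_of_pos hs
        rw [e]
        rw [abs_of_pos hpos] at hb' hK ⊢
        have : d ≤ K * (‖z t‖ + δ t) := by
          refine le_of_mul_le_mul_left ?_ hpos
          linarith
        linarith
    linarith

/-! ### Relay systems: crossing and first-order sliding -/

/-- Solutions of the relay system `x' = L x + e + l • (B x + b)`, where the multiplier `l ∈ [0, 1]`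
vanishes if `φ x + f > 0` and equals `1` if `φ x + f < 0`. -/
structure IsRelaySolution (L B : E →L[ℝ] E) (e b : E) (φ : E →L[ℝ] ℝ) (f : ℝ) (x : ℝ → E) :
    Prop where
  absCont : ∀ s t : ℝ, AbsolutelyContinuousOnInterval x s t
  incl : ∀ᵐ t : ℝ, ∃ l : ℝ, 0 ≤ l ∧ l ≤ 1 ∧ (0 < φ (x t) + f → l = 0) ∧
    (φ (x t) + f < 0 → l = 1) ∧ HasDerivAt x (L (x t) + e + l • (B (x t) + b)) t

theorem HasDerivAt.clm_comp_add_const {F : Type*} [NormedAddCommGroup F] [NormedSpace ℝ F]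
    {x : ℝ → E} {v : E} {t : ℝ} (hx : HasDerivAt x v t) (ψ : E →L[ℝ] F) (c : F) :
    HasDerivAt (fun s => ψ (x s) + c) (ψ v) t :=
  (ψ.hasFDerivAt.comp_hasDerivAt t hx).add_const c

theorem eventually_nhdsGT_zero_iff {P : ℝ → Prop} :
    (∀ᶠ t in 𝓝[>] (0 : ℝ), P t) ↔ ∃ ε > 0, ∀ t ∈ Ioo 0 ε, P t := by
  change {t | P t} ∈ 𝓝[>] (0 : ℝ) ↔ _
  rw [mem_nhdsGT_iff_exists_Ioo_subset]
  rfl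

namespace IsRelaySolution

variable {L B : E →L[ℝ] E} {e b : E} {φ : E →L[ℝ] ℝ} {f : ℝ} {x x' : ℝ → E}

theorem continuous (hx : IsRelaySolution L B e b φ f x) : Continuous x := by
  refine continuous_iff_continuousAt.2 fun t => ?_
  refine (hx.absCont (t - 1) (t + 1)).continuousOn.continuousAt ?_
  rw [uIcc_of_le (by linarith)]
  exact Icc_mem_nhds (by linarith) (by linarith)

theorem eventually_pos (hx : IsRelaySolution L B e b φ f x) {ψ : E → ℝ} (hψ : Continuous ψ)
    (h : 0 < ψ (x 0)) : ∀ᶠ t in 𝓝[>] (0 : ℝ), 0 < ψ (x t) :=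
  ((hψ.comp hx.continuous).continuousAt.eventually (lt_mem_nhds h)).filter_mono nhdsWithin_le_nhds

theorem exists_lower_bound (hx : IsRelaySolution L B e b φ f x) {ψ : E → ℝ} (hψ : Continuous ψ)
    (h : 0 < ψ (x 0)) : ∃ β > 0, ∀ᶠ t in 𝓝[>] (0 : ℝ), β ≤ ψ (x t) := by
  refine ⟨ψ (x 0) / 2, by positivity, ?_⟩
  refine (hx.eventually_pos (ψ := fun p => ψ p - ψ (x 0) / 2) (by fun_prop)
    (by linarith)).mono fun t ht => ?_
  linarith

theorem exists_upper_bound {F : Type*} [NormedAddCommGroup F]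
    (hx : IsRelaySolution L B e b φ f x) {ψ : E → F} (hψ : Continuous ψ) :
    ∃ R ≥ 0, ∀ᶠ t in 𝓝[>] (0 : ℝ), ‖ψ (x t)‖ ≤ R := by
  refine ⟨‖ψ (x 0)‖ + 1, by positivity, ?_⟩
  refine (hx.eventually_pos (ψ := fun p => ‖ψ (x 0)‖ + 1 - ‖ψ p‖) (by fun_prop)
    (by linarith)).mono fun t ht => ?_
  linarith

/-- The velocities of a solution are bounded near the initial time. -/
theorem exists_velocity_bound (hx : IsRelaySolution L B e b φ f x) :
    ∃ V ≥ 0, ∀ᶠ t in 𝓝[>] (0 : ℝ), ∀ l : ℝ, 0 ≤ l → l ≤ 1 →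
      ‖L (x t) + e + l • (B (x t) + b)‖ ≤ V := by
  obtain ⟨R, hR, h⟩ := hx.exists_upper_bound (ψ := fun p => L p + e) (by fun_prop)
  obtain ⟨Q, hQ, h'⟩ := hx.exists_upper_bound (ψ := fun p => B p + b) (by fun_prop)
  refine ⟨R + Q, by positivity, ?_⟩
  filter_upwards [h, h'] with t h1 h2 l hl0 hl1
  refine (norm_add_le _ _).trans (add_le_add h1 ?_)
  rw [norm_smul, Real.norm_of_nonneg hl0]
  nlinarith [norm_nonneg (B (x t) + b)]

/-- The velocity is a convex combination of the two modes, so positivity of `ψ` on both makes `ψ x +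
c` strictly increasing, whatever the multiplier. -/
theorem pos_of_pos_derivs (hx : IsRelaySolution L B e b φ f x) (ψ : E →L[ℝ] ℝ) (c : ℝ)
    (h0 : 0 ≤ ψ (x 0) + c) (h2 : ∀ᶠ t in 𝓝[>] (0 : ℝ), 0 < ψ (L (x t) + e))
    (h1 : ∀ᶠ t in 𝓝[>] (0 : ℝ), 0 < ψ (L (x t) + e + (B (x t) + b))) :
    ∀ᶠ t in 𝓝[>] (0 : ℝ), 0 < ψ (x t) + c := by
  obtain ⟨ε, hε, h⟩ := eventually_nhdsGT_zero_iff.1 (h2.and h1)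
  refine eventually_nhdsGT_zero_iff.2 ⟨ε, hε, fun T hT => h0.trans_lt ?_⟩
  refine ((hx.absCont 0 T).clm_comp_add_const ψ c).lt_of_ae_hasDerivAt_pos hT.1 ?_
  filter_upwards [hx.incl] with t ht hI
  obtain ⟨l, hl0, hl1, -, -, hd⟩ := ht
  refine ⟨_, ?_, hd.clm_comp_add_const ψ c⟩
  obtain ⟨p2, p1⟩ := h t ⟨hI.1, hI.2.trans hT.2⟩
  rw [map_add] at p1
  rw [map_add, map_smul, smul_eq_mul]
  rcases hl0.eq_or_lt with rfl | hl
  · linarith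
  · nlinarith [mul_nonneg (sub_nonneg.2 hl1) p2.le]

/-- Two solutions that both enter the region `φ x + f > 0` coincide. -/
theorem eventuallyEq_of_pos (hx : IsRelaySolution L B e b φ f x)
    (hx' : IsRelaySolution L B e b φ f x') (h0 : x 0 = x' 0)
    (hp : ∀ᶠ t in 𝓝[>] (0 : ℝ), 0 < φ (x t) + f)
    (hp' : ∀ᶠ t in 𝓝[>] (0 : ℝ), 0 < φ (x' t) + f) :
    ∀ᶠ t in 𝓝[>] (0 : ℝ), x t = x' t := by
  obtain ⟨ε, hε, h⟩ := eventually_nhdsGT_zero_iff.1 (hp.and hp')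
  refine eventually_nhdsGT_zero_iff.2 ⟨ε, hε, fun T hT => ?_⟩
  have key := eq_zero_of_ae_hasDerivAt_bound (z := fun t => x t - x' t) (δ := fun _ => 0)
    (K := ‖L‖) hT.1.le ((hx.absCont 0 T).fun_sub (hx'.absCont 0 T))
    (ContDiffOn.absolutelyContinuousOnInterval contDiffOn_const) (by simp [h0]) rfl ?_
  · exact sub_eq_zero.1 key.1
  · filter_upwards [hx.incl, hx'.incl] with t ht ht' hI
    obtain ⟨l, -, -, hl, -, hd⟩ := ht
    obtain ⟨l', -, -, hl', -, hd'⟩ := ht'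
    obtain ⟨p, p'⟩ := h t ⟨hI.1, hI.2.trans hT.2⟩
    rw [hl p, zero_smul, add_zero] at hd
    rw [hl' p', zero_smul, add_zero] at hd'
    refine ⟨_, 0, hd.sub hd', hasDerivAt_const t 0, ?_, by simp⟩
    rw [add_sub_add_right_eq_sub, ← map_sub, abs_zero, add_zero]
    exact L.le_opNorm _

/-- If the jump `B x + b` points strictly into `φ > 0`, then solutions are right-unique. -/
theorem eventuallyEq_of_jump_pos (hx : IsRelaySolution L B e b φ f x)
    (hx' : IsRelaySolution L B e b φ f x') (h0 : x 0 = x' 0) (hj : 0 < φ (B (x' 0) + b)) :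
    ∀ᶠ t in 𝓝[>] (0 : ℝ), x t = x' t := by
  obtain ⟨γ, hγ, hγt⟩ := hx'.exists_lower_bound (ψ := fun p => φ (B p + b)) (by fun_prop) hj
  obtain ⟨Q, hQ, hQt⟩ := hx'.exists_upper_bound (ψ := fun p => B p + b) (by fun_prop)
  obtain ⟨V, hV, hVt⟩ := hx'.exists_velocity_bound
  obtain ⟨ε, hε, h⟩ := eventually_nhdsGT_zero_iff.1 (hγt.and (hQt.and hVt))
  refine eventually_nhdsGT_zero_iff.2 ⟨ε, hε, fun T hT => ?_⟩
  set W := ‖L‖ + ‖B‖ with hW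
  set K₁ := 2 * (‖φ‖ * (‖B‖ * V)) + 2 * (‖φ‖ * Q * W) with hK₁
  have hu : AbsolutelyContinuousOnInterval (fun t => x t - x' t) 0 T :=
    (hx.absCont 0 T).fun_sub (hx'.absCont 0 T)
  have hδ : AbsolutelyContinuousOnInterval (fun t => φ (x t - x' t)) 0 T :=
    hu.lipschitz_comp φ.lipschitz
  have hg : AbsolutelyContinuousOnInterval (fun t => B (x' t) + b) 0 T :=
    (hx'.absCont 0 T).clm_comp_add_const B b
  have hγac : AbsolutelyContinuousOnInterval (fun t => φ (B (x' t) + b)) 0 T :=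
    hg.lipschitz_comp φ.lipschitz
  -- With `u = x - x'` and `g` the jump at `x'`, the pair `φ g • u - φ u • g`, `φ u` controls `u`,
  -- because `φ g ≥ γ`.
  have hu_le : ∀ t ∈ Ioo 0 ε, ‖x t - x' t‖ ≤ (1 + Q) / γ *
      (‖φ (B (x' t) + b) • (x t - x' t) - φ (x t - x' t) • (B (x' t) + b)‖
        + |φ (x t - x' t)|) := by
    intro t ht
    obtain ⟨q1, q2, -⟩ := h t ht
    set u := x t - x' t
    set g := B (x' t) + b
    have e1 : φ g • u = (φ g • u - φ u • g) + φ u • g := by abel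
    have e2 : ‖φ g • u‖ ≤ ‖φ g • u - φ u • g‖ + |φ u| * ‖g‖ := by
      conv_lhs => rw [e1]
      refine (norm_add_le _ _).trans_eq ?_
      rw [norm_smul (φ u), Real.norm_eq_abs]
    rw [norm_smul, Real.norm_of_nonneg (hγ.le.trans q1)] at e2
    rw [div_mul_eq_mul_div, le_div_iff₀ hγ]
    have e3 := mul_le_mul_of_nonneg_right q1 (norm_nonneg u)
    have e4 := mul_le_mul_of_nonneg_left q2 (abs_nonneg (φ u))
    have e5 := mul_nonneg hQ (norm_nonneg (φ g • u - φ u • g))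
    have e6 := abs_nonneg (φ u)
    linarith
  -- The combination `φ g • u - φ u • g` lies in the kernel of `φ`. Its derivative is free of the
  -- uncontrolled term `(l - l') • g`, which cancels, so only `φ u` still sees the multipliers.
  have key := eq_zero_of_ae_hasDerivAt_bound (K := (K₁ + ‖φ‖ * W) * ((1 + Q) / γ)) hT.1.le
    ((hγac.fun_smul hu).fun_sub (hδ.fun_smul hg)) hδ (by simp [h0]) (by simp [h0]) ?_
  · have := hu_le T hT
    rw [key.1, key.2] at this
    simp only [norm_zero, abs_zero, add_zero, mul_zero] at this
    exact sub_eq_zero.1 (norm_le_zero_iff.1 this)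
  · filter_upwards [hx.incl, hx'.incl] with t ht ht' hI
    obtain ⟨l, hl0, hl1, hl, hl2, hd⟩ := ht
    obtain ⟨l', hl0', hl1', hl', hl2', hd'⟩ := ht'
    have htε : t ∈ Ioo 0 ε := ⟨hI.1, hI.2.trans hT.2⟩
    obtain ⟨q1, q2, q3⟩ := h t htε
    have hv' := q3 l' hl0' hl1'
    have hu_le' := hu_le t htε
    set v' := L (x' t) + e + l' • (B (x' t) + b) with hv'def
    have du := hd.fun_sub hd'
    have dδ : HasDerivAt (fun t => φ (x t - x' t)) _ t := φ.hasFDerivAt.comp_hasDerivAt t du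
    have dg := hd'.clm_comp_add_const B b
    have dγ : HasDerivAt (fun t => φ (B (x' t) + b)) _ t := φ.hasFDerivAt.comp_hasDerivAt t dg
    refine ⟨_, _, (dγ.fun_smul du).fun_sub (dδ.fun_smul dg), dδ, ?_, ?_⟩
    all_goals
      set u := x t - x' t with hudef
      set g := B (x' t) + b with hgdef
      have hsub : L (x t) + e + l • (B (x t) + b) - v' = (L u + l • B u) + (l - l') • g := by
        rw [hv'def, hudef, hgdef, map_sub, map_sub]; module
      rw [hsub]
      set w := L u + l • B u with hwdef
      have hw : ‖w‖ ≤ W * ‖u‖ := by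
        rw [hW, add_mul]
        refine (norm_add_le _ _).trans (add_le_add (L.le_opNorm u) ?_)
        rw [norm_smul, Real.norm_of_nonneg hl0]
        exact (mul_le_of_le_one_left (norm_nonneg _) hl1).trans (B.le_opNorm u)
      have hφw : |φ w| ≤ ‖φ‖ * (W * ‖u‖) :=
        (φ.le_opNorm w).trans (mul_le_mul_of_nonneg_left hw (norm_nonneg _))
      have hW0 : 0 ≤ W := by positivity
      have hK₁0 : 0 ≤ K₁ := by positivity
    · have hBv : ‖B v'‖ ≤ ‖B‖ * V :=
        (B.le_opNorm v').trans (mul_le_mul_of_nonneg_left hv' (norm_nonneg _))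
      have hz : φ g • (w + (l - l') • g) + φ (B v') • u
            - (φ u • B v' + φ (w + (l - l') • g) • g)
          = φ g • w + φ (B v') • u - φ u • B v' - φ w • g := by
        rw [map_add φ w, map_smul, smul_eq_mul]; module
      rw [hz]
      have n1 : ‖φ g • w‖ ≤ ‖φ‖ * Q * (W * ‖u‖) := by
        rw [norm_smul]
        gcongr
        exact (φ.le_opNorm g).trans (by gcongr)
      have n2 : ‖φ (B v') • u‖ ≤ ‖φ‖ * (‖B‖ * V) * ‖u‖ := by
        rw [norm_smul]
        gcongr
        exact (φ.le_opNorm _).trans (by gcongr)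
      have n3 : ‖φ u • B v'‖ ≤ ‖φ‖ * ‖u‖ * (‖B‖ * V) := by
        rw [norm_smul]
        gcongr
        exact φ.le_opNorm _
      have n4 : ‖φ w • g‖ ≤ ‖φ‖ * (W * ‖u‖) * Q := by
        rw [norm_smul]
        gcongr
        exact hφw
      have n5 := norm_sub_le (φ g • w + φ (B v') • u - φ u • B v') (φ w • g)
      have n6 := norm_sub_le (φ g • w + φ (B v') • u) (φ u • B v')
      have n7 := norm_add_le (φ g • w) (φ (B v') • u)
      have n8 : ‖φ g • w + φ (B v') • u - φ u • B v' - φ w • g‖ ≤ K₁ * ‖u‖ := by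
        rw [hK₁]; linarith
      refine n8.trans ?_
      rw [mul_assoc]
      exact mul_le_mul (by linarith [mul_nonneg (norm_nonneg φ) hW0]) hu_le' (norm_nonneg _)
        (by positivity)
    -- The relay is monotone: a larger output never comes with a larger multiplier.
    · have hμ : φ u * (l - l') ≤ 0 := by
        have hφu : φ u = (φ (x t) + f) - (φ (x' t) + f) := by rw [hudef, map_sub]; ring
        rcases lt_trichotomy (φ u) 0 with hneg | hzero | hpos
        · refine mul_nonpos_of_nonpos_of_nonneg hneg.le ?_
          rcases lt_or_ge 0 (φ (x' t) + f) with hp | hp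
          · rw [hl' hp]; linarith
          · rw [hl2 (by linarith)]; linarith
        · simp [hzero]
        · refine mul_nonpos_of_nonneg_of_nonpos hpos.le ?_
          rcases lt_or_ge 0 (φ (x t) + f) with hp | hp
          · rw [hl hp]; linarith
          · rw [hl2' (by linarith)]; linarith
      rw [map_add, map_smul, smul_eq_mul, mul_add]
      have m1 : φ u * ((l - l') * φ g) ≤ 0 := by
        rw [← mul_assoc]
        exact mul_nonpos_of_nonpos_of_nonneg hμ (hγ.le.trans q1)
      have m2 : φ u * φ w ≤ |φ u| * (‖φ‖ * (W * ‖u‖)) := by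
        refine (le_abs_self _).trans ?_
        rw [abs_mul]
        gcongr
      have m3 : ‖φ‖ * (W * ‖u‖) ≤ (K₁ + ‖φ‖ * W) * ((1 + Q) / γ) *
          (‖φ g • u - φ u • g‖ + |φ u|) := by
        rw [← mul_assoc, mul_assoc (K₁ + ‖φ‖ * W)]
        exact mul_le_mul (by linarith) hu_le' (norm_nonneg _) (by positivity)
      have m4 := mul_le_mul_of_nonneg_left m3 (abs_nonneg (φ u))
      linarith

end IsRelaySolution

/-! ### Second-order contact with the switching surface -/

/-- A Lyapunov argument for a relay double integrator: the energy
`m₂ a² / 2 + m₂ p max(y, 0) + r max(-y, 0)` stays zero. -/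
theorem eq_zero_of_second_order_attraction {y a p r : ℝ → ℝ} {T m₁ m₂ β₁ β₂ P Q : ℝ}
    (hT : 0 ≤ T) (hm₂ : 0 < m₂) (hβ₁ : 0 < β₁) (hβ₂ : 0 < β₂) (hP : 0 ≤ P) (hQ : 0 ≤ Q)
    (ac_y : AbsolutelyContinuousOnInterval y 0 T) (ac_a : AbsolutelyContinuousOnInterval a 0 T)
    (ac_p : AbsolutelyContinuousOnInterval p 0 T) (ac_r : AbsolutelyContinuousOnInterval r 0 T)
    (hy0 : y 0 = 0) (ha0 : a 0 = 0)
    (hbound : ∀ t ∈ Ioc 0 T, β₁ ≤ p t ∧ β₂ ≤ r t ∧ r t ≤ Q)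
    (h : ∀ᵐ t : ℝ, t ∈ Ioo 0 T → ∃ l y' a' p' r' : ℝ, 0 ≤ l ∧ l ≤ 1 ∧ (0 < y t → l = 0) ∧
      (y t < 0 → l = 1) ∧ HasDerivAt y y' t ∧ HasDerivAt a a' t ∧ HasDerivAt p p' t ∧
      HasDerivAt r r' t ∧ y' = (1 - l) * a t + l * (m₁ * y t + m₂ * a t) ∧
      a' = -(1 - l) * p t + l * r t ∧ p' ≤ P ∧ r' ≤ P) :
    y T = 0 ∧ a T = 0 := by
  rcases hT.eq_or_lt with rfl | hTpos
  · exact ⟨hy0, ha0⟩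
  set C₁ := P / β₁ with hC₁
  set C₂ := (P + Q * |m₁|) / β₂ with hC₂
  have hC₁0 : 0 ≤ C₁ := by positivity
  have hC₂0 : 0 ≤ C₂ := by positivity
  have ac_max : AbsolutelyContinuousOnInterval (fun t => max (y t) 0) 0 T :=
    ac_y.max_zero
  have ac_neg : AbsolutelyContinuousOnInterval (fun t => -y t) 0 T := ac_y.fun_neg
  have ac_min : AbsolutelyContinuousOnInterval (fun t => max (-y t) 0) 0 T :=
    ac_neg.max_zero
  -- The weights make the terms in `a` cancel in both modes: the derivative is `m₂ p' y` for `y > 0`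
  -- and `(r' + m₁ r)(-y)` for `y < 0`, both bounded by a multiple of the energy.
  have ac_E : AbsolutelyContinuousOnInterval (fun t => m₂ / 2 * (a t * a t) +
      (m₂ * p t * max (y t) 0 + r t * max (-y t) 0)) 0 T :=
    ((ac_a.fun_mul ac_a).const_mul (m₂ / 2)).fun_add
      (((ac_p.const_mul m₂).fun_mul ac_max).fun_add (ac_r.fun_mul ac_min))
  have key := ac_E.nonpos_of_ae_hasDerivAt_le_mul (C := C₁ + C₂) hT (by simp [hy0, ha0]) ?_
  · obtain ⟨q1, q2, -⟩ := hbound T ⟨hTpos, le_rfl⟩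
    have k1 : 0 ≤ m₂ / 2 * (a T * a T) := mul_nonneg (by positivity) (mul_self_nonneg _)
    have k2 : m₂ * β₁ * max (y T) 0 ≤ m₂ * p T * max (y T) 0 :=
      mul_le_mul_of_nonneg_right (by gcongr) (le_max_right _ _)
    have k3 := mul_le_mul_of_nonneg_right q2 (le_max_right (-y T) 0)
    have k4 : 0 ≤ m₂ * β₁ * max (y T) 0 := mul_nonneg (by positivity) (le_max_right _ _)
    have k5 : 0 ≤ β₂ * max (-y T) 0 := mul_nonneg (by positivity) (le_max_right _ _)
    have z1 : max (y T) 0 ≤ 0 := by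
      have : m₂ * β₁ * max (y T) 0 ≤ 0 := by linarith
      exact nonpos_of_mul_nonpos_right this (by positivity)
    have z2 : max (-y T) 0 ≤ 0 := by
      have : β₂ * max (-y T) 0 ≤ 0 := by linarith
      exact nonpos_of_mul_nonpos_right this hβ₂
    refine ⟨?_, ?_⟩
    · have := (le_max_left _ _).trans z1
      have := (le_max_left _ _).trans z2
      linarith
    · have z3 : m₂ / 2 * (a T * a T) ≤ 0 := by linarith
      exact mul_self_eq_zero.1 (le_antisymm
        (nonpos_of_mul_nonpos_right z3 (by positivity)) (mul_self_nonneg _))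
  · filter_upwards [h, ae_hasDerivAt_max_zero hT ac_y, ae_hasDerivAt_max_zero hT ac_neg]
      with t ht hmax hmin hI
    obtain ⟨l, y', a', p', r', hl0, hl1, hlp, hln, dy, da, dp, dr, hy', ha', hp', hr'⟩ := ht hI
    obtain ⟨q1, q2, q3⟩ := hbound t ⟨hI.1, hI.2.le⟩
    obtain ⟨d₁, hd₁, hd₁p, hd₁n⟩ := hmax hI _ dy
    obtain ⟨d₂, hd₂, hd₂p, hd₂n⟩ := hmin hI _ dy.fun_neg
    have daa : HasDerivAt (fun t => m₂ / 2 * (a t * a t)) (m₂ / 2 * (a' * a t + a t * a')) t :=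
      (da.fun_mul da).const_mul (m₂ / 2)
    have dpy : HasDerivAt (fun t => m₂ * p t * max (y t) 0)
        (m₂ * p' * max (y t) 0 + m₂ * p t * d₁) t := (dp.const_mul m₂).fun_mul hd₁
    have dry : HasDerivAt (fun t => r t * max (-y t) 0) (r' * max (-y t) 0 + r t * d₂) t :=
      dr.fun_mul hd₂
    refine ⟨_, ?_, daa.fun_add (dpy.fun_add dry)⟩
    have bp : P = C₁ * β₁ := by rw [hC₁, div_mul_cancel₀ _ hβ₁.ne']
    have br : P + Q * |m₁| = C₂ * β₂ := by rw [hC₂, div_mul_cancel₀ _ hβ₂.ne']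
    have haa : 0 ≤ (C₁ + C₂) * (m₂ / 2 * (a t * a t)) :=
      mul_nonneg (by positivity) (mul_nonneg (by positivity) (mul_self_nonneg _))
    rcases lt_trichotomy (y t) 0 with hy | hy | hy
    · have e1 := hd₁n hy.le
      have e2 := hd₂p (by linarith)
      rw [hln hy] at hy' ha'
      rw [e1, e2, hy', ha', max_eq_right hy.le, max_eq_left (by linarith)]
      have : r' + r t * m₁ ≤ (C₁ + C₂) * r t := by
        have s2 : r t * m₁ ≤ Q * |m₁| :=
          (mul_le_mul_of_nonneg_left (le_abs_self m₁) (hβ₂.le.trans q2)).trans (by gcongr)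
        have s3 := mul_le_mul_of_nonneg_left q2 hC₂0
        have s4 : 0 ≤ C₁ * r t := mul_nonneg hC₁0 (hβ₂.le.trans q2)
        linarith
      have := mul_le_mul_of_nonneg_right this (show 0 ≤ -y t by linarith)
      linarith
    · have e1 := hd₁n hy.le
      have e2 := hd₂n (by linarith)
      -- Here `y` is the difference of its positive and negative parts, whose derivatives both
      -- vanish. The relation for `y'` then forces `a t = 0`, so the energy is stationary.
      have e3 : y' = 0 := by
        have := (hd₁.sub hd₂).unique (dy.congr_of_eventuallyEq (Eventually.of_forall fun s => ?_))
        · rw [← this, e1, e2, sub_zero]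
        · simp only [Pi.sub_apply]
          rcases le_total (y s) 0 with hs | hs
          · rw [max_eq_right hs, max_eq_left (by linarith)]; ring
          · rw [max_eq_left hs, max_eq_right (by linarith)]; ring
      have e4 : a t = 0 := by
        have : (1 - l + l * m₂) * a t = 0 := by rw [← e3, hy', hy]; ring
        refine (mul_eq_zero.1 this).resolve_left (ne_of_gt ?_)
        rcases hl0.eq_or_lt with hz | hz
        · rw [← hz]; norm_num
        · have := mul_pos hz hm₂; linarith
      rw [e1, e2, e4, hy]
      simp
    · have e1 := hd₁p hy
      have e2 := hd₂n (by linarith)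
      rw [hlp hy] at hy' ha'
      rw [e1, e2, hy', ha', max_eq_left hy.le, max_eq_right (by linarith)]
      have : p' ≤ (C₁ + C₂) * p t := by
        have s3 := mul_le_mul_of_nonneg_left q1 hC₁0
        have s4 : 0 ≤ C₂ * p t := mul_nonneg hC₂0 (hβ₁.le.trans q1)
        linarith
      have := mul_le_mul_of_nonneg_right this (show 0 ≤ m₂ * y t by positivity)
      linarith

namespace IsRelaySolution

variable {L B : E →L[ℝ] E} {e b : E} {φ : E →L[ℝ] ℝ} {f : ℝ} {x x' : ℝ → E}

/-- If both modes have contact of order one with the switching surface, and their second-order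
terms push strictly away from it into `φ x + f > 0`, then solutions enter `φ x + f > 0`. -/
theorem eventually_pos_of_second_order (hx : IsRelaySolution L B e b φ f x)
    (h0 : 0 ≤ φ (x 0) + f) (h2 : 0 ≤ φ (L (x 0) + e)) (h1 : 0 ≤ φ (L (x 0) + e + (B (x 0) + b)))
    (h22 : 0 < φ (L (L (x 0) + e))) (h21 : 0 < φ (L (L (x 0) + e + (B (x 0) + b))))
    (h12 : 0 < φ ((L + B) (L (x 0) + e)))
    (h11 : 0 < φ ((L + B) (L (x 0) + e + (B (x 0) + b)))) :
    ∀ᶠ t in 𝓝[>] (0 : ℝ), 0 < φ (x t) + f := by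
  refine hx.pos_of_pos_derivs φ f h0 ?_ ?_
  · refine (hx.pos_of_pos_derivs (φ.comp L) (φ e) (by simpa using h2)
      (hx.eventually_pos (ψ := fun p => φ (L (L p + e))) (by fun_prop) h22)
      (hx.eventually_pos (ψ := fun p => φ (L (L p + e + (B p + b)))) (by fun_prop) h21)).mono
      fun t ht => ?_
    simpa using ht
  · refine (hx.pos_of_pos_derivs (φ.comp (L + B)) (φ (e + b)) ?_
      (hx.eventually_pos (ψ := fun p => φ ((L + B) (L p + e))) (by fun_prop) h12)
      (hx.eventually_pos (ψ := fun p => φ ((L + B) (L p + e + (B p + b)))) (by fun_prop) h11)).mono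
      fun t ht => ?_
    · refine h1.trans_eq ?_
      simp only [ContinuousLinearMap.comp_apply, _root_.add_apply, map_add]
      ring
    · refine ht.trans_eq ?_
      simp only [ContinuousLinearMap.comp_apply, _root_.add_apply, map_add]
      ring

/-- At a point of second-order contact that attracts from both sides, solutions stay on the
second-order contact set. -/
theorem eventually_second_order_sliding (hx : IsRelaySolution L B e b φ f x) {m₁ m₂ : ℝ}
    (hm₂ : 0 < m₂)
    (hmode : ∀ p, φ (L p + e + (B p + b)) = m₁ * (φ p + f) + m₂ * φ (L p + e))
    (h0 : φ (x 0) + f = 0) (h2 : φ (L (x 0) + e) = 0)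
    (h22 : φ (L (L (x 0) + e)) < 0) (h21 : 0 < φ (L (L (x 0) + e + (B (x 0) + b)))) :
    ∀ᶠ t in 𝓝[>] (0 : ℝ), φ (x t) + f = 0 ∧ φ (L (x t) + e) = 0 := by
  obtain ⟨β₁, hβ₁, hβ₁t⟩ := hx.exists_lower_bound (ψ := fun p => -φ (L (L p + e)))
    (by fun_prop) (by linarith)
  obtain ⟨β₂, hβ₂, hβ₂t⟩ := hx.exists_lower_bound (ψ := fun p => φ (L (L p + e + (B p + b))))
    (by fun_prop) h21
  obtain ⟨Q, hQ, hQt⟩ := hx.exists_upper_bound (ψ := fun p => φ (L (L p + e + (B p + b))))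
    (by fun_prop)
  obtain ⟨V, hV, hVt⟩ := hx.exists_velocity_bound
  obtain ⟨ε, hε, h⟩ := eventually_nhdsGT_zero_iff.1 (hβ₁t.and (hβ₂t.and (hQt.and hVt)))
  refine eventually_nhdsGT_zero_iff.2 ⟨ε, hε, fun T hT => ?_⟩
  -- `ψ`, `θ`, `η` are the linear parts of the signals `a`, `p`, `r` of the energy lemma: the mode 2
  -- output rate, minus its derivative along mode 2, and its derivative along mode 1.
  obtain ⟨ψ, hψ⟩ : ∃ ψ : E →L[ℝ] ℝ, ∀ p, ψ p = φ (L p) := ⟨φ.comp L, fun _ => rfl⟩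
  obtain ⟨θ, hθ⟩ : ∃ θ : E →L[ℝ] ℝ, ∀ p, θ p = -φ (L (L p)) :=
    ⟨-(φ.comp L).comp L, fun _ => rfl⟩
  obtain ⟨η, hη⟩ : ∃ η : E →L[ℝ] ℝ, ∀ p, η p = φ (L (L p + B p)) :=
    ⟨(φ.comp L).comp (L + B), fun _ => rfl⟩
  have ea : ∀ p, ψ p + φ e = φ (L p + e) := fun p => by rw [hψ, map_add φ]
  have ep : ∀ p, θ p + -φ (L e) = -φ (L (L p + e)) := fun p => by
    rw [hθ, map_add L, map_add φ]; ring
  have er : ∀ p, η p + φ (L (e + b)) = φ (L (L p + e + (B p + b))) := fun p => by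
    rw [hη, ← map_add φ, ← map_add L]; congr 2; abel
  have key := eq_zero_of_second_order_attraction (m₁ := m₁) hT.1.le hm₂ hβ₁ hβ₂
    (P := ‖θ‖ * V + ‖η‖ * V) (Q := Q) (by positivity) hQ
    ((hx.absCont 0 T).clm_comp_add_const φ f) ((hx.absCont 0 T).clm_comp_add_const ψ (φ e))
    ((hx.absCont 0 T).clm_comp_add_const θ (-φ (L e)))
    ((hx.absCont 0 T).clm_comp_add_const η (φ (L (e + b)))) h0 (by rw [ea, h2]) ?_ ?_
  · rwa [ea] at key
  · intro t ht
    obtain ⟨q1, q2, q3, -⟩ := h t ⟨ht.1, ht.2.trans_lt hT.2⟩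
    rw [ep, er]
    exact ⟨q1, q2, (le_abs_self _).trans q3⟩
  · filter_upwards [hx.incl] with t ht hI
    obtain ⟨l, hl0, hl1, hlp, hln, hd⟩ := ht
    have q4 := (h t ⟨hI.1, hI.2.trans hT.2⟩).2.2.2 l hl0 hl1
    refine ⟨l, _, _, _, _, hl0, hl1, hlp, hln, hd.clm_comp_add_const φ f,
      hd.clm_comp_add_const ψ (φ e), hd.clm_comp_add_const θ (-φ (L e)),
      hd.clm_comp_add_const η (φ (L (e + b))), ?_, ?_, ?_, ?_⟩
    · have := hmode (x t)
      rw [map_add φ (L (x t) + e) (B (x t) + b)] at this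
      rw [ea, ← this, map_add φ (L (x t) + e), map_smul, smul_eq_mul]
      ring
    · rw [ep, er, hψ, map_add L (L (x t) + e), map_add L (L (x t) + e), map_add φ, map_add φ,
        map_smul, map_smul, smul_eq_mul]
      ring
    · refine (le_abs_self _).trans ((θ.le_opNorm _).trans ?_)
      have : ‖θ‖ * _ ≤ ‖θ‖ * V := mul_le_mul_of_nonneg_left q4 (norm_nonneg θ)
      have : 0 ≤ ‖η‖ * V := by positivity
      linarith
    · refine (le_abs_self _).trans ((η.le_opNorm _).trans ?_)
      have : ‖η‖ * _ ≤ ‖η‖ * V := mul_le_mul_of_nonneg_left q4 (norm_nonneg η)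
      have : 0 ≤ ‖θ‖ * V := by positivity
      linarith

/-- Solutions that stay on the second-order contact set are right-unique. -/
theorem eventuallyEq_of_second_order_sliding (hx : IsRelaySolution L B e b φ f x)
    (hx' : IsRelaySolution L B e b φ f x') (h0 : x 0 = x' 0)
    (hs : ∀ᶠ t in 𝓝[>] (0 : ℝ), φ (L (x t) + e) = 0)
    (hs' : ∀ᶠ t in 𝓝[>] (0 : ℝ), φ (L (x' t) + e) = 0)
    (hj : 0 < φ (L (B (x' 0) + b))) :
    ∀ᶠ t in 𝓝[>] (0 : ℝ), x t = x' t := by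
  obtain ⟨β, hβ, hβt⟩ := hx'.exists_lower_bound (ψ := fun p => φ (L (B p + b))) (by fun_prop) hj
  obtain ⟨Q, hQ, hQt⟩ := hx'.exists_upper_bound (ψ := fun p => B p + b) (by fun_prop)
  obtain ⟨ε, hε, h⟩ := eventually_nhdsGT_zero_iff.1 (hβt.and (hQt.and (hs.and hs')))
  refine eventually_nhdsGT_zero_iff.2 ⟨ε, hε, fun T hT => ?_⟩
  set ψ := φ.comp L with hψ
  set K := (‖ψ.comp L‖ + ‖ψ.comp B‖) / β with hK
  have key := eq_zero_of_ae_hasDerivAt_bound (z := fun t => x t - x' t) (δ := fun _ => 0)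
    (K := ‖L‖ + ‖B‖ + K * Q) hT.1.le ((hx.absCont 0 T).fun_sub (hx'.absCont 0 T))
    (ContDiffOn.absolutelyContinuousOnInterval contDiffOn_const) (by simp [h0]) rfl ?_
  · exact sub_eq_zero.1 key.1
  · filter_upwards [hx.incl, hx'.incl] with t ht ht' hI
    obtain ⟨l, hl0, hl1, -, -, hd⟩ := ht
    obtain ⟨l', -, -, -, -, hd'⟩ := ht'
    have hnhds : ∀ᶠ s in 𝓝 t, s ∈ Ioo 0 ε := Ioo_mem_nhds hI.1 (hI.2.trans hT.2)
    obtain ⟨q1, q2, -, -⟩ := h t hnhds.self_of_nhds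
    have c1 : ψ (L (x t) + e + l • (B (x t) + b)) = 0 := by
      refine (hd.clm_comp_add_const ψ (φ e)).unique
        ((hasDerivAt_const t (0 : ℝ)).congr_of_eventuallyEq (hnhds.mono fun s hs => ?_))
      simpa [hψ] using (h s hs).2.2.1
    have c2 : ψ (L (x' t) + e + l' • (B (x' t) + b)) = 0 := by
      refine (hd'.clm_comp_add_const ψ (φ e)).unique
        ((hasDerivAt_const t (0 : ℝ)).congr_of_eventuallyEq (hnhds.mono fun s hs => ?_))
      simpa [hψ] using (h s hs).2.2.2
    refine ⟨_, 0, hd.sub hd', hasDerivAt_const t 0, ?_, by simp⟩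
    rw [abs_zero, add_zero]
    have hsub : L (x t) + e + l • (B (x t) + b) - (L (x' t) + e + l' • (B (x' t) + b))
        = L (x t - x' t) + l • B (x t - x' t) + (l - l') • (B (x' t) + b) := by
      rw [map_sub, map_sub]; module
    -- Staying on the contact set makes `ψ` vanish on both velocities; subtracting solves for `l -
    -- l'` linearly in `u`. As `ψ` of the jump is at least `β`, this gives a Lipschitz bound on the
    -- multipliers.
    have hμ : (l - l') * ψ (B (x' t) + b) =
        -((ψ.comp L) (x t - x' t) + l * (ψ.comp B) (x t - x' t)) := by
      have := congrArg ψ hsub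
      rw [map_sub ψ, c1, c2, sub_zero, map_add ψ, map_add ψ, map_smul, map_smul,
        smul_eq_mul, smul_eq_mul] at this
      change _ = -(ψ (L _) + l * ψ (B _))
      linarith
    rw [hsub]
    set u := x t - x' t
    have hμ' : |l - l'| ≤ K * ‖u‖ := by
      rw [hK, div_mul_eq_mul_div, le_div_iff₀ hβ]
      calc |l - l'| * β ≤ |l - l'| * ψ (B (x' t) + b) := by gcongr; exact q1
        _ = |(ψ.comp L) u + l * (ψ.comp B) u| := by
          rw [← abs_neg ((ψ.comp L) u + _), ← hμ, abs_mul,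
            abs_of_pos (a := ψ (B (x' t) + b)) (hβ.trans_le q1)]
        _ ≤ |(ψ.comp L) u| + |l * (ψ.comp B) u| := abs_add_le _ _
        _ ≤ ‖ψ.comp L‖ * ‖u‖ + ‖ψ.comp B‖ * ‖u‖ := by
          refine add_le_add ((ψ.comp L).le_opNorm u) ?_
          rw [abs_mul, abs_of_nonneg hl0]
          exact (mul_le_of_le_one_left (abs_nonneg _) hl1).trans ((ψ.comp B).le_opNorm u)
        _ = _ := by ring
    calc ‖L u + l • B u + (l - l') • (B (x' t) + b)‖
        ≤ ‖L u‖ + ‖l • B u‖ + ‖(l - l') • (B (x' t) + b)‖ := norm_add₃_le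
      _ ≤ ‖L‖ * ‖u‖ + ‖B‖ * ‖u‖ + K * ‖u‖ * Q := by
        refine add_le_add (add_le_add (L.le_opNorm u) ?_) ?_
        · rw [norm_smul, Real.norm_of_nonneg hl0]
          exact (mul_le_of_le_one_left (norm_nonneg _) hl1).trans (B.le_opNorm u)
        · rw [norm_smul, Real.norm_eq_abs]
          gcongr
      _ = _ := by ring

end IsRelaySolution

/-! ### Filippov solutions as relay solutions, and local uniqueness criteria -/

/-- Multiplication by a matrix, as a continuous linear map. -/
noncomputable def mulVecCLM {n : ℕ} (A : Matrix (Fin n) (Fin n) ℝ) :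
    (Fin n → ℝ) →L[ℝ] (Fin n → ℝ) :=
  LinearMap.toContinuousLinearMap A.mulVecLin

/-- The dot product with a fixed vector, as a continuous linear map. -/
noncomputable def dotCLM {n : ℕ} (c : Fin n → ℝ) : (Fin n → ℝ) →L[ℝ] ℝ :=
  LinearMap.toContinuousLinearMap
    { toFun := fun x => c ⬝ᵥ x
      map_add' := dotProduct_add c
      map_smul' := fun k x => dotProduct_smul k c x }

@[simp] theorem mulVecCLM_apply {n : ℕ} (A : Matrix (Fin n) (Fin n) ℝ) (x : Fin n → ℝ) :
    mulVecCLM A x = A *ᵥ x := rfl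

@[simp] theorem dotCLM_apply {n : ℕ} (c x : Fin n → ℝ) : dotCLM c x = c ⬝ᵥ x := rfl

namespace BimodalSystem

variable {n : ℕ} {S : BimodalSystem n} {ξ : Fin n → ℝ} {x x' : ℝ → Fin n → ℝ}

/-- The vector field of mode 1. -/
def field₁ (S : BimodalSystem n) (p : Fin n → ℝ) : Fin n → ℝ := S.A₁ *ᵥ p + S.e₁

/-- The vector field of mode 2. -/
def field₂ (S : BimodalSystem n) (p : Fin n → ℝ) : Fin n → ℝ := S.A₂ *ᵥ p + S.e₂

/-- The same system with the roles of the two modes exchanged. -/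
def swap (S : BimodalSystem n) : BimodalSystem n :=
  ⟨S.A₂, S.A₁, S.e₂, S.e₁, -S.c, -S.f⟩

theorem G_swap (S : BimodalSystem n) (p : Fin n → ℝ) : S.swap.G p = S.G p := by
  have h : -S.c ⬝ᵥ p + -S.f = -(S.c ⬝ᵥ p + S.f) := by rw [neg_dotProduct]; ring
  simp only [G, swap, h]
  rcases lt_trichotomy (S.c ⬝ᵥ p + S.f) 0 with hp | hp | hp
  · rw [if_neg (by linarith), if_neg (by linarith), if_pos hp]
  · simp [hp, Set.pair_comm]
  · rw [if_pos (by linarith), if_neg (by linarith), if_neg (by linarith)]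

theorem IsFilippovSolution.swap (hx : S.IsFilippovSolution ξ x) :
    S.swap.IsFilippovSolution ξ x :=
  ⟨hx.absCont, hx.init, by simpa only [G_swap] using hx.incl⟩

theorem jump_eq (S : BimodalSystem n) (p : Fin n → ℝ) :
    mulVecCLM (S.A₁ - S.A₂) p + (S.e₁ - S.e₂) = S.field₁ p - S.field₂ p := by
  rw [mulVecCLM_apply, sub_mulVec, field₁, field₂]; abel

theorem field_add_jump (S : BimodalSystem n) (p : Fin n → ℝ) :
    mulVecCLM S.A₂ p + S.e₂ + (mulVecCLM (S.A₁ - S.A₂) p + (S.e₁ - S.e₂)) = S.field₁ p := by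
  rw [jump_eq, mulVecCLM_apply, field₂]; abel

/-- Mode 2 is the base field and the multiplier is the weight of mode 1, read off from the convex
hull on the surface. -/
theorem IsFilippovSolution.isRelaySolution (hx : S.IsFilippovSolution ξ x) :
    IsRelaySolution (mulVecCLM S.A₂) (mulVecCLM (S.A₁ - S.A₂)) S.e₂ (S.e₁ - S.e₂)
      (dotCLM S.c) S.f x := by
  refine ⟨hx.absCont, ?_⟩
  filter_upwards [hx.incl] with t ⟨v, hv, hd⟩
  simp only [jump_eq]
  change ∃ l : ℝ, 0 ≤ l ∧ l ≤ 1 ∧ (0 < S.c ⬝ᵥ x t + S.f → l = 0) ∧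
    (S.c ⬝ᵥ x t + S.f < 0 → l = 1) ∧
    HasDerivAt x (S.field₂ (x t) + l • (S.field₁ (x t) - S.field₂ (x t))) t
  rcases lt_trichotomy (S.c ⬝ᵥ x t + S.f) 0 with hp | hp | hp
  · rw [G, if_pos hp, Set.mem_singleton_iff] at hv
    refine ⟨1, zero_le_one, le_rfl, fun h => absurd h hp.not_gt, fun _ => rfl, ?_⟩
    rw [one_smul, add_sub_cancel]
    rw [hv] at hd
    exact hd
  · rw [G, if_neg hp.not_lt, if_pos hp, convexHull_pair] at hv
    obtain ⟨a, l, ha, hl, hal, rfl⟩ := hv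
    refine ⟨1 - l, by linarith, by linarith, fun h => absurd h hp.not_gt,
      fun h => absurd h hp.not_lt, ?_⟩
    convert hd using 1
    obtain rfl : a = 1 - l := by linarith
    change _ = (1 - l) • S.field₁ (x t) + l • S.field₂ (x t)
    module
  · rw [G, if_neg hp.not_gt, if_neg hp.ne', Set.mem_singleton_iff] at hv
    refine ⟨0, le_rfl, zero_le_one, fun _ => rfl, fun h => absurd h hp.not_gt, ?_⟩
    rw [zero_smul, add_zero]
    rw [hv] at hd
    exact hd

/-- Any two Filippov solutions for the initial state `ξ` agree near `0` on the right. -/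
def Agree (S : BimodalSystem n) (ξ : Fin n → ℝ) : Prop :=
  ∀ x x' : ℝ → Fin n → ℝ, S.IsFilippovSolution ξ x → S.IsFilippovSolution ξ x' →
    ∀ᶠ t in 𝓝[>] (0 : ℝ), x t = x' t

theorem Agree.rightUniqueAt (h : S.Agree ξ) : S.RightUniqueAt ξ := by
  intro x hx x' hx'
  obtain ⟨ε, hε, hεt⟩ := eventually_nhdsGT_zero_iff.1 (h x x' hx hx')
  refine ⟨ε, hε, fun t ht => ?_⟩
  rcases ht.1.eq_or_lt with rfl | hpos
  · rw [hx.init, hx'.init]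
  · exact hεt t ⟨hpos, ht.2⟩

theorem agree_of_swap (h : S.swap.Agree ξ) : S.Agree ξ :=
  fun x x' hx hx' => h x x' hx.swap hx'.swap

theorem agree_of_eventually_pos
    (h : ∀ x, S.IsFilippovSolution ξ x → ∀ᶠ t in 𝓝[>] (0 : ℝ), 0 < S.c ⬝ᵥ x t + S.f) :
    S.Agree ξ := fun x x' hx hx' =>
  hx.isRelaySolution.eventuallyEq_of_pos hx'.isRelaySolution (by rw [hx.init, hx'.init])
    (h x hx) (h x' hx')

theorem agree_of_pos (h : 0 < S.c ⬝ᵥ ξ + S.f) : S.Agree ξ :=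
  agree_of_eventually_pos fun _ hx => hx.isRelaySolution.eventually_pos
    (ψ := fun p => dotCLM S.c p + S.f) (by fun_prop) (by simpa [hx.init] using h)

theorem agree_of_crossing (h0 : S.c ⬝ᵥ ξ + S.f = 0) (h1 : 0 < S.c ⬝ᵥ S.field₁ ξ)
    (h2 : 0 < S.c ⬝ᵥ S.field₂ ξ) : S.Agree ξ := by
  refine agree_of_eventually_pos fun x hx => ?_
  refine hx.isRelaySolution.pos_of_pos_derivs (dotCLM S.c) S.f ?_ ?_ ?_
  · simp [hx.init, h0]
  · exact hx.isRelaySolution.eventually_pos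
      (ψ := fun p => dotCLM S.c (mulVecCLM S.A₂ p + S.e₂)) (by fun_prop)
      (by rw [hx.init]; exact h2)
  · exact hx.isRelaySolution.eventually_pos
      (ψ := fun p => dotCLM S.c (mulVecCLM S.A₂ p + S.e₂ +
        (mulVecCLM (S.A₁ - S.A₂) p + (S.e₁ - S.e₂)))) (by fun_prop)
      (by simpa only [hx.init, field_add_jump, dotCLM_apply] using h1)

theorem agree_of_second_order_crossing (h0 : S.c ⬝ᵥ ξ + S.f = 0) (h1 : S.c ⬝ᵥ S.field₁ ξ = 0)
    (h2 : S.c ⬝ᵥ S.field₂ ξ = 0)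
    (h11 : 0 < S.c ⬝ᵥ (S.A₁ *ᵥ S.field₁ ξ)) (h12 : 0 < S.c ⬝ᵥ (S.A₁ *ᵥ S.field₂ ξ))
    (h21 : 0 < S.c ⬝ᵥ (S.A₂ *ᵥ S.field₁ ξ)) (h22 : 0 < S.c ⬝ᵥ (S.A₂ *ᵥ S.field₂ ξ)) :
    S.Agree ξ := by
  refine agree_of_eventually_pos fun x hx => ?_
  have hA : mulVecCLM S.A₂ + mulVecCLM (S.A₁ - S.A₂) = mulVecCLM S.A₁ := by
    ext1 p; simp [sub_mulVec]
  refine hx.isRelaySolution.eventually_pos_of_second_order ?_ ?_ ?_ ?_ ?_ ?_ ?_ <;>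
    simp only [hx.init, field_add_jump, hA]
  · exact h0.ge
  · exact h2.ge
  · exact h1.ge
  · exact h22
  · exact h21
  · exact h12
  · exact h11

theorem agree_of_jump_pos (h : S.c ⬝ᵥ S.field₂ ξ < S.c ⬝ᵥ S.field₁ ξ) : S.Agree ξ := by
  intro x x' hx hx'
  refine hx.isRelaySolution.eventuallyEq_of_jump_pos hx'.isRelaySolution
    (by rw [hx.init, hx'.init]) ?_
  rw [hx'.init, jump_eq, dotCLM_apply, dotProduct_sub]
  linarith

theorem agree_of_second_order_sliding {m₁ m₂ : ℝ} (hm₂ : 0 < m₂)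
    (hmode : ∀ p, S.c ⬝ᵥ S.field₁ p = m₁ * (S.c ⬝ᵥ p + S.f) + m₂ * (S.c ⬝ᵥ S.field₂ p))
    (h0 : S.c ⬝ᵥ ξ + S.f = 0) (h2 : S.c ⬝ᵥ S.field₂ ξ = 0)
    (h21 : 0 < S.c ⬝ᵥ (S.A₂ *ᵥ S.field₁ ξ)) (h22 : S.c ⬝ᵥ (S.A₂ *ᵥ S.field₂ ξ) < 0) :
    S.Agree ξ := by
  have slide : ∀ x, S.IsFilippovSolution ξ x → ∀ᶠ t in 𝓝[>] (0 : ℝ),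
      dotCLM S.c (mulVecCLM S.A₂ (x t) + S.e₂) = 0 := by
    intro x hx
    refine (hx.isRelaySolution.eventually_second_order_sliding (m₁ := m₁) hm₂
      ?_ ?_ ?_ ?_ ?_).mono fun t ht => ht.2
    · intro p
      rw [field_add_jump]
      exact hmode p
    · rw [hx.init]; exact h0
    · rw [hx.init]; exact h2
    · rw [hx.init]; exact h22
    · rw [hx.init, field_add_jump]; exact h21
  intro x x' hx hx'
  refine hx.isRelaySolution.eventuallyEq_of_second_order_sliding hx'.isRelaySolution
    (by rw [hx.init, hx'.init]) (slide x hx) (slide x' hx') ?_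
  rw [hx'.init, jump_eq, dotCLM_apply, mulVecCLM_apply, mulVec_sub, dotProduct_sub]
  linarith

end BimodalSystem

/-! ### Output derivatives and the lower triangular relation -/

theorem obsMatrix_mulVec {n : ℕ} (c : Fin n → ℝ) (A : Matrix (Fin n) (Fin n) ℝ)
    (p : Fin n → ℝ) :
    obsMatrix c A *ᵥ p = ![c ⬝ᵥ p, c ⬝ᵥ (A *ᵥ p), c ⬝ᵥ ((A ^ 2) *ᵥ p)] := by
  ext i
  fin_cases i
  · rfl
  · exact (dotProduct_mulVec c A p).symm
  · exact (dotProduct_mulVec c (A ^ 2) p).symm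

/-- The value, the first and the second derivative of the output along an affine vector field. -/
theorem obsMatrix_mulVec_add_affineVec {n : ℕ} (c : Fin n → ℝ) (f : ℝ)
    (A : Matrix (Fin n) (Fin n) ℝ) (e p : Fin n → ℝ) :
    obsMatrix c A *ᵥ p + affineVec c f A e =
      ![c ⬝ᵥ p + f, c ⬝ᵥ (A *ᵥ p + e), c ⬝ᵥ (A *ᵥ (A *ᵥ p + e))] := by
  rw [obsMatrix_mulVec, affineVec, mulVec_add, dotProduct_add, dotProduct_add, mulVec_mulVec,
    ← pow_two]
  ext i
  fin_cases i <;> rfl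

theorem mulVec_fin_three_of_lower {M : Matrix (Fin 3) (Fin 3) ℝ}
    (hM : ∀ i j, i < j → M i j = 0) (u₀ u₁ u₂ : ℝ) :
    M *ᵥ ![u₀, u₁, u₂] =
      ![M 0 0 * u₀, M 1 0 * u₀ + M 1 1 * u₁, M 2 0 * u₀ + M 2 1 * u₁ + M 2 2 * u₂] := by
  have h01 := hM 0 1 (by decide)
  have h02 := hM 0 2 (by decide)
  have h12 := hM 1 2 (by decide)
  ext i
  fin_cases i <;> simp [mulVec, dotProduct, Fin.sum_univ_three, h01, h02, h12]

end

/-! ### Case analysis on the signs of the output derivatives -/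

open BimodalSystem in
theorem theorem4 {n : ℕ} (S : BimodalSystem n)
    (hM : ∃ M : Matrix (Fin 3) (Fin 3) ℝ,
      (∀ i j, i < j → M i j = 0) ∧ (∀ i, 0 < M i i) ∧
      obsMatrix S.c S.A₁ = M * obsMatrix S.c S.A₂ ∧
      LexGT (affineVec S.c S.f S.A₁ S.e₁) (M *ᵥ affineVec S.c S.f S.A₂ S.e₂)) :
    ∀ ξ : Fin n → ℝ, ξ ∉ S.exceptionalSet → S.RightUniqueAt ξ := by
  obtain ⟨M, hlow, hdiag, hobs, hlex⟩ := hM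
  intro ξ hξ
  refine Agree.rightUniqueAt ?_
  obtain ⟨i, hi, hlt⟩ := hlex
  set d := affineVec S.c S.f S.A₁ S.e₁ - M *ᵥ affineVec S.c S.f S.A₂ S.e₂ with hd
  have rel : ∀ p, obsMatrix S.c S.A₁ *ᵥ p + affineVec S.c S.f S.A₁ S.e₁ =
      M *ᵥ (obsMatrix S.c S.A₂ *ᵥ p + affineVec S.c S.f S.A₂ S.e₂) + d := by
    intro p
    rw [hobs, mulVec_add, mulVec_mulVec, hd]
    abel
  simp only [obsMatrix_mulVec_add_affineVec, mulVec_fin_three_of_lower hlow] at rel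
  have rel₀ : ∀ p, S.c ⬝ᵥ p + S.f = M 0 0 * (S.c ⬝ᵥ p + S.f) + d 0 :=
    fun p => congrFun (rel p) 0
  have rel₁ : ∀ p, S.c ⬝ᵥ S.field₁ p =
      M 1 0 * (S.c ⬝ᵥ p + S.f) + M 1 1 * (S.c ⬝ᵥ S.field₂ p) + d 1 :=
    fun p => congrFun (rel p) 1
  have rel₂ : S.c ⬝ᵥ (S.A₁ *ᵥ S.field₁ ξ) = M 2 0 * (S.c ⬝ᵥ ξ + S.f) +
      M 2 1 * (S.c ⬝ᵥ S.field₂ ξ) + M 2 2 * (S.c ⬝ᵥ (S.A₂ *ᵥ S.field₂ ξ)) + d 2 :=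
    congrFun (rel ξ) 2
  -- This fixes the signs of the mixed terms `cᵀA₁F₂` and `cᵀA₂F₁`, which the lexicographic
  -- condition does not address.
  have lin : ∀ v, S.c ⬝ᵥ (S.A₁ *ᵥ v) = M 1 0 * (S.c ⬝ᵥ v) + M 1 1 * (S.c ⬝ᵥ (S.A₂ *ᵥ v)) := by
    intro v
    have h := congrArg (· *ᵥ v) hobs
    simp only [← mulVec_mulVec, obsMatrix_mulVec, mulVec_fin_three_of_lower hlow] at h
    exact congrFun h 1
  have sw_c : ∀ v, S.swap.c ⬝ᵥ v = -(S.c ⬝ᵥ v) := fun v => neg_dotProduct S.c v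
  rcases lt_trichotomy (S.c ⬝ᵥ ξ + S.f) 0 with hy | hy | hy
  · refine agree_of_swap (agree_of_pos ?_)
    rw [sw_c]
    change 0 < -(S.c ⬝ᵥ ξ) + -S.f
    linarith
  swap
  · exact agree_of_pos hy
  have sw_y : S.swap.c ⬝ᵥ ξ + S.swap.f = 0 := by
    rw [sw_c]
    change -(S.c ⬝ᵥ ξ) + -S.f = 0
    linarith
  have sw_1 : S.swap.field₁ ξ = S.field₂ ξ := rfl
  have sw_2 : S.swap.field₂ ξ = S.field₁ ξ := rfl
  have sw_A₁ : S.swap.A₁ = S.A₂ := rfl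
  have sw_A₂ : S.swap.A₂ = S.A₁ := rfl
  have m1 := hdiag 1
  have m2 := hdiag 2
  have d0 : d 0 = 0 := by have := rel₀ ξ; rw [hy, mul_zero] at this; linarith
  have r₁ := rel₁ ξ
  rw [hy, mul_zero, zero_add] at r₁ rel₂
  have cross_up : 0 < S.c ⬝ᵥ S.field₁ ξ → 0 < S.c ⬝ᵥ S.field₂ ξ → S.Agree ξ :=
    agree_of_crossing hy
  have cross_down : S.c ⬝ᵥ S.field₁ ξ < 0 → S.c ⬝ᵥ S.field₂ ξ < 0 → S.Agree ξ := fun h1 h2 =>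
    agree_of_swap (agree_of_crossing sw_y (by rw [sw_c, sw_1]; linarith)
      (by rw [sw_c, sw_2]; linarith))
  obtain rfl | rfl | rfl : i = 0 ∨ i = 1 ∨ i = 2 := by fin_cases i <;> simp
  · exact absurd d0 hi.ne'
  · rcases lt_or_ge (S.c ⬝ᵥ S.field₂ ξ) (S.c ⬝ᵥ S.field₁ ξ) with h | h
    · exact agree_of_jump_pos h
    · rcases lt_trichotomy (S.c ⬝ᵥ S.field₂ ξ) 0 with h2 | h2 | h2
      · exact cross_down (by linarith) h2
      · rw [h2, mul_zero] at r₁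
        linarith
      · exact cross_up (by linarith [mul_pos m1 h2]) h2
  · have d1 : d 1 = 0 := hlt 1 (by decide)
    rw [d1, add_zero] at r₁
    rcases lt_trichotomy (S.c ⬝ᵥ S.field₂ ξ) 0 with h2 | h2 | h2
    · exact cross_down (by linarith [mul_neg_of_pos_of_neg m1 h2]) h2
    swap
    · exact cross_up (by linarith [mul_pos m1 h2]) h2
    have h1 : S.c ⬝ᵥ S.field₁ ξ = 0 := by rw [r₁, h2, mul_zero]
    have l₁ := lin (S.field₁ ξ)
    have l₂ := lin (S.field₂ ξ)
    rw [h1, mul_zero, zero_add] at l₁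
    rw [h2, mul_zero, zero_add] at l₂
    rw [h2, mul_zero, zero_add] at rel₂
    -- This and its companion are the only uses of `ξ ∉ Ω`: one mode has vanishing second derivative
    -- while the other points strictly towards its opposite side.
    have not_exc₁ : S.c ⬝ᵥ (S.A₁ *ᵥ S.field₁ ξ) = 0 → 0 ≤ S.c ⬝ᵥ (S.A₂ *ᵥ S.field₂ ξ) := by
      intro h
      by_contra! hneg
      refine hξ (Or.inl ⟨?_, ?_⟩)
      · rw [obsMatrix_mulVec_add_affineVec]
        change ![S.c ⬝ᵥ ξ + S.f, S.c ⬝ᵥ S.field₁ ξ, S.c ⬝ᵥ (S.A₁ *ᵥ S.field₁ ξ)] = 0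
        rw [hy, h1, h]
        simp
      · rw [field₂, mulVec_add, dotProduct_add, mulVec_mulVec, ← pow_two] at hneg
        linarith
    have not_exc₂ : S.c ⬝ᵥ (S.A₂ *ᵥ S.field₂ ξ) = 0 → S.c ⬝ᵥ (S.A₁ *ᵥ S.field₁ ξ) ≤ 0 := by
      intro h
      by_contra! hpos
      refine hξ (Or.inr ⟨?_, ?_⟩)
      · rw [obsMatrix_mulVec_add_affineVec]
        change ![S.c ⬝ᵥ ξ + S.f, S.c ⬝ᵥ S.field₂ ξ, S.c ⬝ᵥ (S.A₂ *ᵥ S.field₂ ξ)] = 0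
        rw [hy, h2, h]
        simp
      · rw [field₁, mulVec_add, dotProduct_add, mulVec_mulVec, ← pow_two] at hpos
        linarith
    rcases lt_trichotomy (S.c ⬝ᵥ (S.A₂ *ᵥ S.field₂ ξ)) 0 with h22 | h22 | h22
    · rcases lt_trichotomy (S.c ⬝ᵥ (S.A₁ *ᵥ S.field₁ ξ)) 0 with h11 | h11 | h11
      · have h12 := mul_neg_of_pos_of_neg m1 h22
        have h21 : S.c ⬝ᵥ (S.A₂ *ᵥ S.field₁ ξ) < 0 := by
          rw [l₁] at h11
          exact neg_of_mul_neg_right h11 m1.le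
        refine agree_of_swap (agree_of_second_order_crossing sw_y ?_ ?_ ?_ ?_ ?_ ?_) <;>
          simp only [sw_c, sw_1, sw_2, sw_A₁, sw_A₂] <;> linarith
      · exact absurd (not_exc₁ h11) h22.not_ge
      · have h21 : 0 < S.c ⬝ᵥ (S.A₂ *ᵥ S.field₁ ξ) := by
          rw [l₁] at h11
          exact pos_of_mul_pos_right h11 m1.le
        refine agree_of_second_order_sliding (m₁ := M 1 0) m1 (fun p => ?_) hy h2 h21 h22
        rw [rel₁ p, d1, add_zero]
    -- Here `cᵀA₁F₁ = d 2 > 0`, which `not_exc₂` forbids.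
    · have := not_exc₂ h22
      rw [h22, mul_zero, zero_add] at rel₂
      linarith
    · have h12 := mul_pos m1 h22
      have h11 : 0 < S.c ⬝ᵥ (S.A₁ *ᵥ S.field₁ ξ) := by linarith [mul_pos m2 h22]
      have h21 : 0 < S.c ⬝ᵥ (S.A₂ *ᵥ S.field₁ ξ) := by
        rw [l₁] at h11
        exact pos_of_mul_pos_right h11 m1.le
      exact agree_of_second_order_crossing hy h1 h2 h11 (by linarith) h21 h22
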